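/- Let $d\ge 1$ and $N\ge 0$ be integers, let $\Omega\subset\mathbb R^d$ be a bounded open set (for instance a bounded Lipschitz domain), let $\delta>0$, and put $\Omega_\delta=\{x\in\mathbb R^d\setminus\Omega:\operatorname{dist}(x,\partial\Omega)<\delta\}$. Let $\gamma_\delta(\rho)=\delta^{-(d+2)}\gamma_1(\rho/\delta)$, where $\gamma_1$ is nonnegative on $[0,\infty)$, nonincreasing on $(0,\infty)$ (possibly singular at $0$), vanishes on $[1,\infty)$, and satisfies $\int_{B_1(0)}\gamma_1(|z|)|z|^2\,dz=d$. Let $S_\delta(\Omega;\mathbb C)$ be the space of all $u\in L^2(\Omega\cup\Omega_\delta;\mathbb C)$ with $u=0$ a.e. on $\Omega_\delta$ and $$\|u\|_{S_\delta(\Omega;\mathbb C)}^2=\iint_{(\Omega\cup\Omega_\delta)^2}\gamma_\delta(|y-x|)\,|u(y)-u(x)|^2\,dy\,dx<\infty .$$ For $a\in L^\infty((\Omega\cup\Omega_\delta)^2;\mathbb C)$ and a continuous antilinear functional $f$ on $S_\delta(\Omega;\mathbb C)$, a weak solution with coefficient $a$ and right-hand side $f$ is a function $u\in S_\delta(\Omega;\mathbb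 C)$ such that $$\iint_{(\Omega\cup\Omega_\delta)^2}a(x,y)\,\gamma_\delta(|y-x|)\,(u(y)-u(x))\,\overline{(v(y)-v(x))}\,dy\,dx=\langle f,v\rangle\qquad\text{for all }v\in S_\delta(\Omega;\mathbb C).$$ Let $A:\mathbb C^N\to L^\infty((\Omega\cup\Omega_\delta)^2;\mathbb C)$ be holomorphic, and suppose that there are constants $r_c,R_c\in\mathbb R$ with $$0<r_c\le \operatorname{Re}A(x,y,\hat\xi)\le |A(x,y,\hat\xi)|\le R_c<\infty$$ for a.e. $(x,y)\in(\Omega\cup\Omega_\delta)^2$ and every $\hat\xi$ in the closed polydisc $\hat\Gamma=\{\hat\xi\in\mathbb C^N:|\hat\xi_{(i)}|\le 1,\ 1\le i\le N\}$. Then there is an open set $U\subset\mathbb C^N$ containing $\hat\Gamma$ such that, for every continuous antilinear functional $f$ on $S_\delta(\Omega;\mathbb C)$ and every $\hat\xi\in U$, there is exactly one weak solution $u^\delta(\hat\xi)\in S_\delta(\Omega;\mathbb C)$ with coefficient $A(\cdot,\cdot,\hat\xi)$ and right-hand side $f$, and the map $\hat\xi\mapsto u^\delta(\hat\xi)$ is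 holomorphic from $U$ to $S_\delta(\Omega;\mathbb C)$. -/

import Mathlib

open MeasureTheory

noncomputable section

namespace NonlocalDiffusion

/-- Assumptions on the radial profile `γ₁` of the kernel in dimension `d`: nonnegative,
nonincreasing (a singularity at the origin is allowed), supported in the unit ball, and normalized
by `∫_{B₁(0)} γ₁(|z|) |z|² dz = d`. -/
structure IsKernelProfile (d : ℕ) (γ₁ : ℝ → ℝ) : Prop where
  nonneg : ∀ ρ : ℝ, 0 ≤ ρ → 0 ≤ γ₁ ρ
  antitone : AntitoneOn γ₁ (Set.Ioi 0)
  support : ∀ ρ : ℝ, 1 ≤ ρ → γ₁ ρ = 0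
  normalized :
    ∫ z in Metric.ball (0 : EuclideanSpace ℝ (Fin d)) 1, γ₁ ‖z‖ * ‖z‖ ^ 2 = (d : ℝ)

/-- The rescaled kernel `γ_δ(ρ) = δ^{-(d+2)} γ₁(ρ / δ)`. -/
def kernel (d : ℕ) (γ₁ : ℝ → ℝ) (δ ρ : ℝ) : ℝ :=
  1 / δ ^ (d + 2) * γ₁ (ρ / δ)

/-- The nonlocal boundary `Ω_δ = {x ∉ Ω : dist(x, ∂Ω) < δ}`. -/
def collar {d : ℕ} (Ω : Set (EuclideanSpace ℝ (Fin d))) (δ : ℝ) :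
    Set (EuclideanSpace ℝ (Fin d)) :=
  Metric.thickening δ (frontier Ω) \ Ω

/-- Lebesgue measure on `Ω ∪ Ω_δ`. -/
def vol {d : ℕ} (Ω : Set (EuclideanSpace ℝ (Fin d))) (δ : ℝ) :
    Measure (EuclideanSpace ℝ (Fin d)) :=
  volume.restrict (Ω ∪ collar Ω δ)

instance {d : ℕ} (Ω : Set (EuclideanSpace ℝ (Fin d))) (δ : ℝ) : SigmaFinite (vol Ω δ) := by
  unfold vol; infer_instance

/-- Lebesgue measure on `(Ω ∪ Ω_δ)²`. -/
def vol₂ {d : ℕ} (Ω : Set (EuclideanSpace ℝ (Fin d))) (δ : ℝ) :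
    Measure (EuclideanSpace ℝ (Fin d) × EuclideanSpace ℝ (Fin d)) :=
  (vol Ω δ).prod (vol Ω δ)

/-- The scalar nonlocal gradient `(x, y) ↦ √γ_δ(|y - x|) (u(y) - u(x))`. Its squared modulus is
`γ_δ(|y - x|) |u(y) - u(x)|²`. -/
def grad {d : ℕ} (γ₁ : ℝ → ℝ) (δ : ℝ) (u : EuclideanSpace ℝ (Fin d) → ℂ)
    (p : EuclideanSpace ℝ (Fin d) × EuclideanSpace ℝ (Fin d)) : ℂ :=
  ((√(kernel d γ₁ δ ‖p.2 - p.1‖) : ℝ) : ℂ) * (u p.2 - u p.1)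

theorem ae_comp_eq {d : ℕ} {Ω : Set (EuclideanSpace ℝ (Fin d))} {δ : ℝ}
    {u v : EuclideanSpace ℝ (Fin d) → ℂ} (h : u =ᵐ[vol Ω δ] v) :
    ∀ᵐ p ∂(vol₂ Ω δ), u p.1 = v p.1 ∧ u p.2 = v p.2 :=
  (Measure.quasiMeasurePreserving_fst.ae h).and (Measure.quasiMeasurePreserving_snd.ae h)

theorem grad_congr {d : ℕ} {Ω : Set (EuclideanSpace ℝ (Fin d))} {γ₁ : ℝ → ℝ} {δ : ℝ}
    {u v : EuclideanSpace ℝ (Fin d) → ℂ} (h : u =ᵐ[vol Ω δ] v) :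
    grad γ₁ δ u =ᵐ[vol₂ Ω δ] grad γ₁ δ v := by
  filter_upwards [ae_comp_eq h] with p hp
  simp [grad, hp.1, hp.2]

theorem grad_add {d : ℕ} (γ₁ : ℝ → ℝ) (δ : ℝ) (u v : EuclideanSpace ℝ (Fin d) → ℂ) :
    grad γ₁ δ (u + v) = grad γ₁ δ u + grad γ₁ δ v := by
  funext p; simp only [grad, Pi.add_apply]; ring

theorem grad_smul {d : ℕ} (γ₁ : ℝ → ℝ) (δ : ℝ) (c : ℂ) (u : EuclideanSpace ℝ (Fin d) → ℂ) :
    grad γ₁ δ (c • u) = c • grad γ₁ δ u := by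
  funext p; simp only [grad, Pi.smul_apply, smul_eq_mul]; ring

theorem grad_zero {d : ℕ} (γ₁ : ℝ → ℝ) (δ : ℝ) :
    grad γ₁ δ (0 : EuclideanSpace ℝ (Fin d) → ℂ) = 0 := by
  funext p; simp [grad]

/-- The complex energy space `S_δ(Ω; ℂ)` as a subspace of `L²(Ω ∪ Ω_δ; ℂ)`: finite energy, and
zero on `Ω_δ`. -/
def energySubmodule {d : ℕ} (Ω : Set (EuclideanSpace ℝ (Fin d))) (γ₁ : ℝ → ℝ) (δ : ℝ) :
    Submodule ℂ (Lp ℂ 2 (vol Ω δ)) where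
  carrier := {u | MemLp (grad γ₁ δ u) 2 (vol₂ Ω δ) ∧
    ∀ᵐ x ∂(vol Ω δ), x ∈ collar Ω δ → u x = 0}
  add_mem' := by
    rintro u v ⟨hu, hu0⟩ ⟨hv, hv0⟩
    refine ⟨?_, ?_⟩
    · refine (memLp_congr_ae (grad_congr (Lp.coeFn_add u v))).2 ?_
      rw [grad_add]; exact hu.add hv
    · filter_upwards [hu0, hv0, Lp.coeFn_add u v] with x h1 h2 h3 hx
      rw [h3, Pi.add_apply, h1 hx, h2 hx, add_zero]
  zero_mem' := by
    refine ⟨?_, ?_⟩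
    · refine (memLp_congr_ae (grad_congr (Lp.coeFn_zero ℂ 2 (vol Ω δ)))).2 ?_
      rw [grad_zero]; exact MemLp.zero
    · filter_upwards [Lp.coeFn_zero ℂ 2 (vol Ω δ)] with x h3 _
      rw [h3, Pi.zero_apply]
  smul_mem' := by
    rintro c u ⟨hu, hu0⟩
    refine ⟨?_, ?_⟩
    · refine (memLp_congr_ae (grad_congr (Lp.coeFn_smul c u))).2 ?_
      rw [grad_smul]; exact hu.const_smul c
    · filter_upwards [hu0, Lp.coeFn_smul c u] with x h1 h3 hx
      rw [h3, Pi.smul_apply, h1 hx, smul_zero]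

/-- The space `S_δ(Ω; ℂ)`; a new type, since it carries the energy norm and not the norm
of `L²`. -/
def EnergySpace {d : ℕ} (Ω : Set (EuclideanSpace ℝ (Fin d))) (γ₁ : ℝ → ℝ) (δ : ℝ) : Type :=
  energySubmodule Ω γ₁ δ

namespace EnergySpace

instance {d : ℕ} (Ω : Set (EuclideanSpace ℝ (Fin d))) (γ₁ : ℝ → ℝ) (δ : ℝ) :
    AddCommGroup (EnergySpace Ω γ₁ δ) :=
  inferInstanceAs (AddCommGroup (energySubmodule Ω γ₁ δ))

instance {d : ℕ} (Ω : Set (EuclideanSpace ℝ (Fin d))) (γ₁ : ℝ → ℝ) (δ : ℝ) :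
    Module ℂ (EnergySpace Ω γ₁ δ) :=
  inferInstanceAs (Module ℂ (energySubmodule Ω γ₁ δ))

/-- The inclusion `S_δ(Ω; ℂ) ⊆ L²(Ω ∪ Ω_δ; ℂ)`. -/
def toL2 {d : ℕ} (Ω : Set (EuclideanSpace ℝ (Fin d))) (γ₁ : ℝ → ℝ) (δ : ℝ) :
    EnergySpace Ω γ₁ δ →ₗ[ℂ] Lp ℂ 2 (vol Ω δ) :=
  (energySubmodule Ω γ₁ δ).subtype

instance {d : ℕ} (Ω : Set (EuclideanSpace ℝ (Fin d))) (γ₁ : ℝ → ℝ) (δ : ℝ) :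
    CoeFun (EnergySpace Ω γ₁ δ) (fun _ => EuclideanSpace ℝ (Fin d) → ℂ) :=
  ⟨fun u => toL2 Ω γ₁ δ u⟩

theorem memLp_grad {d : ℕ} {Ω : Set (EuclideanSpace ℝ (Fin d))} {γ₁ : ℝ → ℝ} {δ : ℝ}
    (u : EnergySpace Ω γ₁ δ) : MemLp (grad γ₁ δ u) 2 (vol₂ Ω δ) :=
  u.2.1

/-- The nonlocal gradient as a linear map `S_δ(Ω; ℂ) → L²((Ω ∪ Ω_δ)²; ℂ)`. -/
def gradL2 {d : ℕ} (Ω : Set (EuclideanSpace ℝ (Fin d))) (γ₁ : ℝ → ℝ) (δ : ℝ) :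
    EnergySpace Ω γ₁ δ →ₗ[ℂ] Lp ℂ 2 (vol₂ Ω δ) where
  toFun u := MemLp.toLp (grad γ₁ δ u) (memLp_grad u)
  map_add' u v := by
    rw [← MemLp.toLp_add (memLp_grad u) (memLp_grad v)]
    refine MemLp.toLp_congr _ _ ?_
    rw [← grad_add, map_add]
    exact grad_congr (Lp.coeFn_add _ _)
  map_smul' c u := by
    rw [RingHom.id_apply, ← MemLp.toLp_const_smul c (memLp_grad u)]
    refine MemLp.toLp_congr _ _ ?_
    rw [← grad_smul, map_smul]
    exact grad_congr (Lp.coeFn_smul _ _)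

/-- The energy norm `‖u‖ = ‖√γ_δ(|y - x|) (u(y) - u(x))‖_{L²((Ω ∪ Ω_δ)²)}`; see `norm_sq_eq`.
By the nonlocal Poincaré inequality it vanishes only at `0` when `Ω` is bounded, `d ≥ 1`, `δ > 0` and
`γ₁` is a kernel profile. -/
instance {d : ℕ} (Ω : Set (EuclideanSpace ℝ (Fin d))) (γ₁ : ℝ → ℝ) (δ : ℝ) :
    SeminormedAddCommGroup (EnergySpace Ω γ₁ δ) :=
  SeminormedAddCommGroup.induced _ _ (gradL2 Ω γ₁ δ)

instance {d : ℕ} (Ω : Set (EuclideanSpace ℝ (Fin d))) (γ₁ : ℝ → ℝ) (δ : ℝ) :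
    NormedSpace ℂ (EnergySpace Ω γ₁ δ) :=
  NormedSpace.induced ℂ _ _ (gradL2 Ω γ₁ δ)

theorem norm_eq {d : ℕ} {Ω : Set (EuclideanSpace ℝ (Fin d))} {γ₁ : ℝ → ℝ} {δ : ℝ}
    (u : EnergySpace Ω γ₁ δ) : ‖u‖ = ‖gradL2 Ω γ₁ δ u‖ := rfl

theorem norm_sq_eq {d : ℕ} {Ω : Set (EuclideanSpace ℝ (Fin d))} {γ₁ : ℝ → ℝ} {δ : ℝ}
    (hδ : 0 < δ) (hγ : IsKernelProfile d γ₁) (u : EnergySpace Ω γ₁ δ) :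
    ‖u‖ ^ 2 = ∫ p, kernel d γ₁ δ ‖p.2 - p.1‖ * ‖u p.2 - u p.1‖ ^ 2 ∂(vol₂ Ω δ) := by
  have h := L2.inner_def (𝕜 := ℂ) (gradL2 Ω γ₁ δ u) (gradL2 Ω γ₁ δ u)
  rw [inner_self_eq_norm_sq_to_K] at h
  have h2 : ∀ᵐ p ∂(vol₂ Ω δ), inner ℂ (gradL2 Ω γ₁ δ u p) (gradL2 Ω γ₁ δ u p)
      = ((kernel d γ₁ δ ‖p.2 - p.1‖ * ‖u p.2 - u p.1‖ ^ 2 : ℝ) : ℂ) := by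
    filter_upwards [MemLp.coeFn_toLp (memLp_grad u)] with p hp
    have hk : 0 ≤ kernel d γ₁ δ ‖p.2 - p.1‖ :=
      mul_nonneg (by positivity) (hγ.nonneg _ (by positivity))
    have : gradL2 Ω γ₁ δ u p = grad γ₁ δ u p := hp
    have h3 : ‖grad γ₁ δ u p‖ ^ 2 = kernel d γ₁ δ ‖p.2 - p.1‖ * ‖u p.2 - u p.1‖ ^ 2 := by
      rw [grad, norm_mul, mul_pow, Complex.norm_real, Real.norm_eq_abs, sq_abs, Real.sq_sqrt hk]
    rw [this, inner_self_eq_norm_sq_to_K, ← h3]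
    exact (Complex.ofReal_pow _ 2).symm
  rw [integral_congr_ae h2, integral_complex_ofReal] at h
  rw [norm_eq]
  exact Complex.ofReal_injective ((Complex.ofReal_pow _ 2).trans h)

end EnergySpace

/-- The sesquilinear form
`T_δ[u, v] = ∬ a(x, y) γ_δ(|y - x|) (u(y) - u(x)) conj(v(y) - v(x)) dy dx` over `(Ω ∪ Ω_δ)²`
with complex coefficient `a ∈ L^∞((Ω ∪ Ω_δ)²)`. -/
def form {d : ℕ} {Ω : Set (EuclideanSpace ℝ (Fin d))} {γ₁ : ℝ → ℝ} {δ : ℝ}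
    (a : Lp ℂ ⊤ (vol₂ Ω δ)) (u v : EnergySpace Ω γ₁ δ) : ℂ :=
  ∫ p, a p * ((kernel d γ₁ δ ‖p.2 - p.1‖ : ℝ) : ℂ) * (u p.2 - u p.1) *
    (starRingEnd ℂ) (v p.2 - v p.1) ∂(vol₂ Ω δ)

/-- `u ∈ S_δ(Ω; ℂ)` is a weak solution of the nonlocal diffusion problem with coefficient `a`,
right-hand side `f` (a continuous antilinear functional, such as `v ↦ ∫ f conj(v)`), and zero
boundary datum on `Ω_δ`. -/
def IsWeakSolution {d : ℕ} {Ω : Set (EuclideanSpace ℝ (Fin d))} {γ₁ : ℝ → ℝ} {δ : ℝ}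
    (a : Lp ℂ ⊤ (vol₂ Ω δ)) (f : EnergySpace Ω γ₁ δ →L⋆[ℂ] ℂ) (u : EnergySpace Ω γ₁ δ) : Prop :=
  ∀ v : EnergySpace Ω γ₁ δ, form a u v = f v

/-- The closed unit polydisc of `ℂ^N`. -/
def polydisc (N : ℕ) : Set (Fin N → ℂ) := {ξ | ∀ i, ‖ξ i‖ ≤ 1}

end NonlocalDiffusion

end

noncomputable section

namespace NonlocalDiffusion

open Set ENNReal NNReal Filter Topology

/-! The nonlocal gradient identifies `S_δ(Ω; ℂ)` isometrically with a subspace of L²((Ω ∪ Ω_δ)²).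
The Poincaré inequality (`exists_poincare`) makes this identification injective and its range closed
(`isClosed_range_gradL2`), so the range V is a Hilbert space. To prove it, note that a function
supported in the bounded set Ω vanishes after enough equal steps z of length less than δ.
Telescoping bounds its L² norm by that of one difference along z, and averaging over an annulus of
steps gives the energy.

With ι the inclusion of V in L² and M_a multiplication by a, the form is that of the compression
B(a) = ι* M_a ι, which is linear and bounded in a. By Riesz, the weak problem reads B(a)k = F in V.
If Re a ≥ r > 0 and |a| ≤ R, a Neumann series inverts B(a) (`isUnit_compressL`).

Let U be the set of ξ for which B(A ξ) is invertible. It does not depend on f, contains the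
polydisc, and is open because units are open. The solution is the image of B(A ξ)⁻¹F, holomorphic
because inversion is. -/

/-! ### The nonlocal Poincaré inequality -/

/-- The scaled kernel is bounded below by a positive constant near the origin. -/
theorem exists_kernel_lower_bound {d : ℕ} (hd : 0 < d) {γ₁ : ℝ → ℝ} (hγ : IsKernelProfile d γ₁)
    {δ : ℝ} (hδ : 0 < δ) :
    ∃ h c : ℝ, 0 < h ∧ h ≤ δ ∧ 0 < c ∧ ∀ ρ, 0 < ρ → ρ < h → c ≤ kernel d γ₁ δ ρ := by
  -- If no such radius existed, the normalizing integral would be 0 instead of d.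
  obtain ⟨ρ₀, h0, hpos⟩ : ∃ ρ₀ : ℝ, 0 < ρ₀ ∧ 0 < γ₁ ρ₀ := by
    by_contra! hcon
    have hz : ∀ z : EuclideanSpace ℝ (Fin d), γ₁ ‖z‖ * ‖z‖ ^ 2 = 0 := by
      intro z
      rcases eq_or_ne z 0 with rfl | hz
      · simp
      · rw [le_antisymm (hcon _ (norm_pos_iff.2 hz)) (hγ.nonneg _ (norm_nonneg z)), zero_mul]
    have := hγ.normalized
    simp only [hz, integral_zero] at this
    exact hd.ne (by exact_mod_cast this)
  have h1 : ρ₀ < 1 := by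
    by_contra! h
    exact hpos.ne' (hγ.support _ h)
  refine ⟨δ * ρ₀, 1 / δ ^ (d + 2) * γ₁ ρ₀, by positivity, by nlinarith, by positivity, ?_⟩
  intro ρ hρ hlt
  refine mul_le_mul_of_nonneg_left (hγ.antitone (div_pos hρ hδ) h0 ?_) (by positivity)
  rw [div_le_iff₀ hδ]
  linarith

/-- Points within distance `δ` of `Ω` belong to `Ω ∪ Ω_δ`. -/
theorem mem_union_collar {d : ℕ} {Ω : Set (EuclideanSpace ℝ (Fin d))} {δ : ℝ}
    {x y : EuclideanSpace ℝ (Fin d)} (hx : x ∈ Ω) (hxy : dist x y < δ) : y ∈ Ω ∪ collar Ω δ := by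
  by_cases hy : y ∈ Ω
  · exact Or.inl hy
  refine Or.inr ⟨?_, hy⟩
  -- A segment from Ω to its complement must meet the frontier; otherwise the interior of Ω and the
  -- exterior would disconnect it.
  obtain ⟨z, hz, hzf⟩ : (segment ℝ x y ∩ frontier Ω).Nonempty := by
    by_contra hne
    have hcov : ∀ z ∈ segment ℝ x y, z ∈ closure Ω → z ∈ interior Ω := fun z hz hc => by
      by_contra hi
      exact hne ⟨z, hz, hc, hi⟩
    obtain ⟨z, -, hz1, hz2⟩ := (convex_segment x y).isPreconnected (interior Ω) (closure Ω)ᶜ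
      isOpen_interior isClosed_closure.isOpen_compl
      (fun z hz => (em (z ∈ closure Ω)).imp (hcov z hz) id)
      ⟨x, left_mem_segment ℝ x y, hcov x (left_mem_segment ℝ x y) (subset_closure hx)⟩
      ⟨y, right_mem_segment ℝ x y,
        fun hc => hy (interior_subset (hcov y (right_mem_segment ℝ x y) hc))⟩
    exact hz2 (interior_subset_closure hz1)
  rw [Metric.mem_thickening_iff]
  refine ⟨z, hzf, ?_⟩
  have := dist_add_dist_of_mem_segment hz
  rw [dist_comm y z]
  linarith [dist_nonneg (x := x) (y := z)]

/-- The union of `Ω` and its collar is open. -/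
theorem isOpen_union_collar {d : ℕ} {Ω : Set (EuclideanSpace ℝ (Fin d))} (hΩ : IsOpen Ω) (δ : ℝ) :
    IsOpen (Ω ∪ collar Ω δ) := by
  rw [collar, Set.union_sdiff_self]
  exact hΩ.union Metric.isOpen_thickening

/-- Differences of a function along `n` equal steps. -/
theorem eLpNorm_nsmul_translate_sub_le {E : Type*} [NormedAddCommGroup E] [MeasurableSpace E]
    [BorelSpace E] {μ : Measure E} [μ.IsAddRightInvariant] {f : E → ℂ}
    (hf : StronglyMeasurable f) (z : E) (n : ℕ) :
    eLpNorm (fun x => f (x + n • z) - f x) 2 μ ≤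
      n * eLpNorm (fun x => f (x + z) - f x) 2 μ := by
  have hm : ∀ w : E, StronglyMeasurable fun x => f (x + w) := fun w =>
    hf.comp_measurable (continuous_id.add continuous_const).measurable
  induction n with
  | zero => simp
  | succ n ih =>
    have hsplit : (fun x => f (x + (n + 1) • z) - f x) =
        (fun x => f (x + n • z + z) - f (x + n • z)) + fun x => f (x + n • z) - f x := by
      funext x
      simp [succ_nsmul, add_assoc]
    have hshift : eLpNorm (fun x => f (x + n • z + z) - f (x + n • z)) 2 μ =
        eLpNorm (fun x => f (x + z) - f x) 2 μ :=
      eLpNorm_comp_measurePreserving (g := fun x => f (x + z) - f x)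
        ((hm z).sub hf).aestronglyMeasurable (measurePreserving_add_right μ (n • z))
    rw [hsplit]
    refine (eLpNorm_add_le ?_ ?_ (by norm_num)).trans ?_
    · exact (((hm z).sub hf).comp_measurable
        (continuous_id.add continuous_const).measurable).aestronglyMeasurable
    · exact ((hm _).sub hf).aestronglyMeasurable
    · rw [hshift, Nat.cast_add, add_mul, Nat.cast_one, one_mul, add_comm]
      gcongr

/-- A function supported in a ball is controlled by its differences along a step with a multiple
longer than the diameter of the ball. -/
theorem eLpNorm_le_nsmul_translate_sub {E : Type*} [NormedAddCommGroup E] [NormedSpace ℝ E]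
    [MeasurableSpace E] [BorelSpace E] {μ : Measure E} [μ.IsAddRightInvariant] {f : E → ℂ}
    (hf : StronglyMeasurable f) {M : ℝ} (hM : ∀ x, f x ≠ 0 → ‖x‖ ≤ M) {z : E} {n : ℕ}
    (hz : 2 * M < n * ‖z‖) :
    eLpNorm f 2 μ ≤ n * eLpNorm (fun x => f (x + z) - f x) 2 μ := by
  refine le_trans (eLpNorm_mono fun x => ?_) (eLpNorm_nsmul_translate_sub_le hf z n)
  by_cases hx : f x = 0
  · simp [hx]
  have : f (x + n • z) = 0 := by
    by_contra hne
    have h1 := hM _ hne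
    have h2 := hM _ hx
    have h3 : ‖n • z‖ ≤ ‖x + n • z‖ + ‖x‖ := by
      simpa using norm_sub_le (x + n • z) x
    rw [← Nat.cast_smul_eq_nsmul ℝ, norm_smul, Real.norm_natCast,
      Nat.cast_smul_eq_nsmul ℝ] at h3
    linarith
  simp [this]

theorem eLpNorm_two_sq {α : Type*} [MeasurableSpace α] {μ : Measure α} (f : α → ℂ) :
    eLpNorm f 2 μ ^ 2 = ∫⁻ x, ‖f x‖ₑ ^ 2 ∂μ := by
  have := eLpNorm_nnreal_pow_eq_lintegral (f := f) (μ := μ) (p := 2) (by norm_num)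
  simpa using this

theorem enorm_grad_sq {d : ℕ} {γ₁ : ℝ → ℝ} (hγ : IsKernelProfile d γ₁) {δ : ℝ} (hδ : 0 < δ)
    (u : EuclideanSpace ℝ (Fin d) → ℂ) (p : EuclideanSpace ℝ (Fin d) × EuclideanSpace ℝ (Fin d)) :
    ‖grad γ₁ δ u p‖ₑ ^ 2 =
      ENNReal.ofReal (kernel d γ₁ δ ‖p.2 - p.1‖) * ‖u p.2 - u p.1‖ₑ ^ 2 := by
  have hk : 0 ≤ kernel d γ₁ δ ‖p.2 - p.1‖ :=
    mul_nonneg (by positivity) (hγ.nonneg _ (by positivity))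
  rw [grad, enorm_mul, mul_pow]
  congr 1
  rw [← ofReal_norm, Complex.norm_real, Real.norm_of_nonneg (Real.sqrt_nonneg _),
    ← ENNReal.ofReal_pow (Real.sqrt_nonneg _), Real.sq_sqrt hk]

/-- Integrating short differences over all translations is controlled by the energy. -/
theorem lintegral_translate_sub_le {d : ℕ} {Ω : Set (EuclideanSpace ℝ (Fin d))} (hΩ : IsOpen Ω)
    {γ₁ : ℝ → ℝ} (hγ : IsKernelProfile d γ₁) {δ h c : ℝ} (hδ : 0 < δ) (hh : h ≤ δ)
    (hc : ∀ ρ, 0 < ρ → ρ < h → c ≤ kernel d γ₁ δ ρ)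
    {f : EuclideanSpace ℝ (Fin d) → ℂ} (hf : StronglyMeasurable f) (hf0 : ∀ x, x ∉ Ω → f x = 0) :
    ∫⁻ z in Metric.ball 0 h, ∫⁻ x, ENNReal.ofReal c * ‖f (x + z) - f x‖ₑ ^ 2 ≤
      eLpNorm (grad γ₁ δ f) 2 (vol₂ Ω δ) ^ 2 := by
  set D := Ω ∪ collar Ω δ with hD
  have hDm : MeasurableSet D := (isOpen_union_collar hΩ δ).measurableSet
  set S : Set (EuclideanSpace ℝ (Fin d) × EuclideanSpace ℝ (Fin d)) := {p | ‖p.2 - p.1‖ < h}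
  have hS : MeasurableSet S :=
    (isOpen_lt (continuous_snd.sub continuous_fst).norm continuous_const).measurableSet
  set g : EuclideanSpace ℝ (Fin d) × EuclideanSpace ℝ (Fin d) → ℝ≥0∞ :=
    S.indicator fun p => ENNReal.ofReal c * ‖f p.2 - f p.1‖ₑ ^ 2 with hg
  have hgm : Measurable g := by
    refine Measurable.indicator (Measurable.const_mul (Measurable.pow_const ?_ 2) _) hS
    exact ((hf.measurable.comp measurable_snd).sub (hf.measurable.comp measurable_fst)).enorm
  -- A nonzero short difference has an endpoint in Ω, so the other is within δ of Ω and both lie in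
  -- Ω ∪ Ω_δ.
  have hgD : (D ×ˢ D).indicator g = g := by
    refine Set.indicator_eq_self.2 fun p hp => ?_
    have hpS : ‖p.2 - p.1‖ < h := by
      by_contra hcon
      exact hp (Set.indicator_of_notMem (s := S) hcon _)
    have hne : ¬ (f p.1 = 0 ∧ f p.2 = 0) := by
      rintro ⟨h1, h2⟩
      refine hp ?_
      rw [hg, Set.indicator_of_mem (show p ∈ S from hpS), h1, h2]
      simp
    rw [← dist_eq_norm] at hpS
    by_cases h1 : p.1 ∈ Ω
    · exact ⟨Or.inl h1, mem_union_collar h1 (by rw [dist_comm]; linarith)⟩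
    · have h2 : p.2 ∈ Ω := by
        by_contra h2
        exact hne ⟨hf0 _ h1, hf0 _ h2⟩
      exact ⟨mem_union_collar h2 (by linarith), Or.inl h2⟩
  have hgle : ∀ p, g p ≤ ‖grad γ₁ δ f p‖ₑ ^ 2 := by
    intro p
    by_cases hp : p ∈ S
    · rw [hg, Set.indicator_of_mem hp, enorm_grad_sq hγ hδ]
      -- The kernel bound excludes radius 0, but the difference vanishes on the diagonal.
      rcases eq_or_ne p.2 p.1 with h12 | h12
      · simp [h12]
      · gcongr
        exact hc _ (norm_pos_iff.2 (sub_ne_zero.2 h12)) hp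
    · rw [hg, Set.indicator_of_notMem hp]
      exact zero_le
  calc ∫⁻ z in Metric.ball 0 h, ∫⁻ x, ENNReal.ofReal c * ‖f (x + z) - f x‖ₑ ^ 2
      = ∫⁻ z in Metric.ball 0 h, ∫⁻ x, g (x, x + z) := by
        refine setLIntegral_congr_fun Metric.isOpen_ball.measurableSet fun z hz => ?_
        refine lintegral_congr fun x => ?_
        rw [hg, Set.indicator_of_mem]
        simpa [S] using hz
    _ ≤ ∫⁻ z, ∫⁻ x, g (x, x + z) := setLIntegral_le_lintegral _ _
    _ = ∫⁻ x, ∫⁻ z, g (x, x + z) := by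
        refine lintegral_lintegral_swap (Measurable.aemeasurable ?_)
        exact hgm.comp (measurable_snd.prodMk (measurable_snd.add measurable_fst))
    _ = ∫⁻ x, ∫⁻ y, g (x, y) := lintegral_congr fun x => lintegral_add_left_eq_self (fun y => g (x, y)) x
    _ = ∫⁻ p, g p ∂(volume.prod volume) := (lintegral_prod _ hgm.aemeasurable).symm
    _ = ∫⁻ p, g p ∂(vol₂ Ω δ) := by
        rw [vol₂, vol, Measure.prod_restrict, ← lintegral_indicator (hDm.prod hDm), hgD]
    _ ≤ ∫⁻ p, ‖grad γ₁ δ f p‖ₑ ^ 2 ∂(vol₂ Ω δ) := lintegral_mono hgle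
    _ = _ := (eLpNorm_two_sq _).symm

/-- The nonlocal Poincaré inequality for functions vanishing outside `Ω`. -/
theorem exists_poincare_eLpNorm {d : ℕ} (hd : 0 < d) {Ω : Set (EuclideanSpace ℝ (Fin d))}
    (hΩ : IsOpen Ω) (hΩb : Bornology.IsBounded Ω) {γ₁ : ℝ → ℝ} (hγ : IsKernelProfile d γ₁)
    {δ : ℝ} (hδ : 0 < δ) :
    ∃ C : ℝ≥0, ∀ f : EuclideanSpace ℝ (Fin d) → ℂ, StronglyMeasurable f →
      (∀ x, x ∉ Ω → f x = 0) →
      eLpNorm f 2 volume ^ 2 ≤ C * eLpNorm (grad γ₁ δ f) 2 (vol₂ Ω δ) ^ 2 := by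
  obtain ⟨h, c, hh, hhδ, hc, hker⟩ := exists_kernel_lower_bound hd hγ hδ
  obtain ⟨M, hM⟩ := hΩb.exists_norm_le
  obtain ⟨n, hn⟩ := exists_nat_gt (2 * M / (h / 2))
  rw [div_lt_iff₀ (by positivity)] at hn
  -- On this annulus the steps are short enough for the kernel bound and long enough that n of them
  -- leave Ω, for one common n.
  set T : Set (EuclideanSpace ℝ (Fin d)) := {z | h / 2 < ‖z‖} ∩ Metric.ball 0 h
  have hTo : IsOpen T := (isOpen_lt continuous_const continuous_norm).inter Metric.isOpen_ball
  have hTne : T.Nonempty := by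
    have : Nonempty (Fin d) := ⟨⟨0, hd⟩⟩
    obtain ⟨z, hz⟩ := exists_norm_eq (EuclideanSpace ℝ (Fin d)) (c := 3 * h / 4) (by positivity)
    refine ⟨z, ?_, ?_⟩
    · change h / 2 < ‖z‖
      linarith
    · rw [mem_ball_zero_iff]
      linarith
  have hT0 : volume T ≠ 0 := (hTo.measure_pos volume hTne).ne'
  have hTtop : volume T ≠ ⊤ :=
    ((measure_mono Set.inter_subset_right).trans_lt measure_ball_lt_top).ne
  have hc0 : ENNReal.ofReal c ≠ 0 := by simpa using hc
  have hctop : ENNReal.ofReal c ≠ ⊤ := ENNReal.ofReal_ne_top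
  have hCtop : (n : ℝ≥0∞) ^ 2 / (ENNReal.ofReal c * volume T) ≠ ⊤ :=
    ENNReal.div_ne_top (by finiteness) (mul_ne_zero hc0 hT0)
  refine ⟨((n : ℝ≥0∞) ^ 2 / (ENNReal.ofReal c * volume T)).toNNReal, fun f hf hf0 => ?_⟩
  rw [ENNReal.coe_toNNReal hCtop, div_eq_mul_inv, mul_right_comm, ← div_eq_mul_inv,
    ENNReal.le_div_iff_mul_le (Or.inl (mul_ne_zero hc0 hT0))
      (Or.inl (ENNReal.mul_ne_top hctop hTtop))]
  have hstep : ∀ z ∈ T, ENNReal.ofReal c * eLpNorm f 2 volume ^ 2 ≤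
      n ^ 2 * ∫⁻ x, ENNReal.ofReal c * ‖f (x + z) - f x‖ₑ ^ 2 := by
    intro z hz
    have h1 : eLpNorm f 2 volume ≤ n * eLpNorm (fun x => f (x + z) - f x) 2 volume := by
      refine eLpNorm_le_nsmul_translate_sub hf (M := M) (fun x hx => hM x ?_) ?_
      · by_contra hx'
        exact hx (hf0 x hx')
      · have : h / 2 < ‖z‖ := hz.1
        exact hn.trans_le (by gcongr)
    rw [lintegral_const_mul' _ _ hctop, ← eLpNorm_two_sq, mul_left_comm, ← mul_pow]
    gcongr
  calc eLpNorm f 2 volume ^ 2 * (ENNReal.ofReal c * volume T)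
      = ∫⁻ _ in T, ENNReal.ofReal c * eLpNorm f 2 volume ^ 2 := by
        rw [setLIntegral_const]; ring
    _ ≤ ∫⁻ z in T, n ^ 2 * ∫⁻ x, ENNReal.ofReal c * ‖f (x + z) - f x‖ₑ ^ 2 :=
        setLIntegral_mono' hTo.measurableSet hstep
    _ = n ^ 2 * ∫⁻ z in T, ∫⁻ x, ENNReal.ofReal c * ‖f (x + z) - f x‖ₑ ^ 2 :=
        lintegral_const_mul' _ _ (by finiteness)
    _ ≤ n ^ 2 * ∫⁻ z in Metric.ball 0 h, ∫⁻ x, ENNReal.ofReal c * ‖f (x + z) - f x‖ₑ ^ 2 := by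
        gcongr
        exact Set.inter_subset_right
    _ ≤ n ^ 2 * eLpNorm (grad γ₁ δ f) 2 (vol₂ Ω δ) ^ 2 := by
        gcongr
        exact lintegral_translate_sub_le hΩ hγ hδ hhδ hker hf hf0

namespace EnergySpace

/-- The nonlocal Poincaré inequality on `S_δ(Ω; ℂ)`. -/
theorem exists_poincare {d : ℕ} (hd : 0 < d) {Ω : Set (EuclideanSpace ℝ (Fin d))}
    (hΩ : IsOpen Ω) (hΩb : Bornology.IsBounded Ω) {γ₁ : ℝ → ℝ} (hγ : IsKernelProfile d γ₁)
    {δ : ℝ} (hδ : 0 < δ) :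
    ∃ C : ℝ≥0, ∀ u : EnergySpace Ω γ₁ δ, ‖toL2 Ω γ₁ δ u‖ ≤ C * ‖gradL2 Ω γ₁ δ u‖ := by
  obtain ⟨C, hC⟩ := exists_poincare_eLpNorm hd hΩ hΩb hγ hδ
  refine ⟨NNReal.sqrt C, fun u => ?_⟩
  -- Since u vanishes a.e. on the collar, extension by zero from Ω does not change its class and
  -- gives a representative vanishing everywhere off Ω.
  set f : EuclideanSpace ℝ (Fin d) → ℂ := Ω.indicator u
  have hf : StronglyMeasurable f := (Lp.stronglyMeasurable _).indicator hΩ.measurableSet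
  have hfu : (u : EuclideanSpace ℝ (Fin d) → ℂ) =ᵐ[vol Ω δ] f := by
    have hmem : ∀ᵐ x ∂(vol Ω δ), x ∈ Ω ∪ collar Ω δ :=
      ae_restrict_mem (isOpen_union_collar hΩ δ).measurableSet
    have hu0 : ∀ᵐ x ∂(vol Ω δ), x ∈ collar Ω δ → u x = 0 := u.2.2
    filter_upwards [hmem, hu0] with x hx h0
    by_cases hxΩ : x ∈ Ω
    · exact (Set.indicator_of_mem hxΩ _).symm
    · rw [h0 (hx.resolve_left hxΩ)]
      exact (Set.indicator_of_notMem hxΩ _).symm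
  have hgrad : ‖gradL2 Ω γ₁ δ u‖ₑ = eLpNorm (grad γ₁ δ f) 2 (vol₂ Ω δ) := by
    rw [Lp.enorm_def, ← eLpNorm_congr_ae (grad_congr hfu)]
    exact eLpNorm_congr_ae (MemLp.coeFn_toLp (memLp_grad u))
  have hL2 : ‖toL2 Ω γ₁ δ u‖ₑ ≤ eLpNorm f 2 volume := by
    rw [Lp.enorm_def, eLpNorm_congr_ae hfu]
    exact eLpNorm_mono_measure _ Measure.restrict_le_self
  have hmain : ‖toL2 Ω γ₁ δ u‖ₑ ^ 2 ≤ C * ‖gradL2 Ω γ₁ δ u‖ₑ ^ 2 := by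
    rw [hgrad]
    exact (pow_le_pow_left' hL2 2).trans
      (hC f hf fun x hx => Set.indicator_of_notMem hx _)
  rw [enorm_eq_nnnorm, enorm_eq_nnnorm] at hmain
  norm_cast at hmain
  have := NNReal.sqrt_le_sqrt.2 hmain
  rw [NNReal.sqrt_sq, NNReal.sqrt_mul, NNReal.sqrt_sq] at this
  exact NNReal.coe_le_coe.2 this

end EnergySpace

/-! ### Compressed multiplication operators -/

/-- Multiplication of `L²` functions by `L^∞` functions. -/
def mulL {α : Type*} [MeasurableSpace α] (μ : Measure α) :
    Lp ℂ ⊤ μ →L[ℂ] Lp ℂ 2 μ →L[ℂ] Lp ℂ 2 μ :=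
  (ContinuousLinearMap.mul ℂ ℂ).holderL μ ⊤ 2 2

theorem coeFn_mulL {α : Type*} [MeasurableSpace α] {μ : Measure α} (a : Lp ℂ ⊤ μ) (g : Lp ℂ 2 μ) :
    mulL μ a g =ᵐ[μ] fun x => a x * g x :=
  (ContinuousLinearMap.mul ℂ ℂ).coeFn_holder a g

theorem norm_mulL_apply_le {α : Type*} [MeasurableSpace α] {μ : Measure α} (a : Lp ℂ ⊤ μ)
    (g : Lp ℂ 2 μ) : ‖mulL μ a g‖ ≤ ‖a‖ * ‖g‖ := by
  have h : ‖mulL μ a g‖ ≤ ‖ContinuousLinearMap.mul ℂ ℂ‖ * ‖a‖ * ‖g‖ :=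
    ContinuousLinearMap.norm_holder_apply_apply_le (r := 2) (ContinuousLinearMap.mul ℂ ℂ) a g
  simpa using h

/-- The compression `ι* a ι` to a Hilbert space embedded by `ι` in `L²` of the multiplication by an
`L^∞` function `a`. -/
def compressL {α V : Type*} [MeasurableSpace α] {μ : Measure α} [NormedAddCommGroup V]
    [InnerProductSpace ℂ V] [CompleteSpace V] (ι : V →ₗᵢ[ℂ] Lp ℂ 2 μ) :
    Lp ℂ ⊤ μ →L[ℂ] V →L[ℂ] V :=
  ((ContinuousLinearMap.adjoint ι.toContinuousLinearMap).postcomp V) ∘L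
    (ι.toContinuousLinearMap.precomp (Lp ℂ 2 μ)) ∘L mulL μ

section compressL

variable {α V : Type*} [MeasurableSpace α] {μ : Measure α} [NormedAddCommGroup V]
  [InnerProductSpace ℂ V] [CompleteSpace V] (ι : V →ₗᵢ[ℂ] Lp ℂ 2 μ)

theorem inner_compressL (a : Lp ℂ ⊤ μ) (k l : V) :
    inner ℂ l (compressL ι a k) = inner ℂ (ι l) (mulL μ a (ι k)) :=
  ContinuousLinearMap.adjoint_inner_right ι.toContinuousLinearMap l (mulL μ a (ι k))

theorem norm_compressL_le (a : Lp ℂ ⊤ μ) : ‖compressL ι a‖ ≤ ‖a‖ := by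
  refine ContinuousLinearMap.opNorm_le_bound _ (norm_nonneg a) fun k => ?_
  have h1 : ‖ContinuousLinearMap.adjoint ι.toContinuousLinearMap‖ ≤ 1 := by
    rw [LinearIsometryEquiv.norm_map]
    exact ι.norm_toContinuousLinearMap_le
  calc ‖compressL ι a k‖ ≤ 1 * ‖mulL μ a (ι k)‖ :=
        ContinuousLinearMap.le_of_opNorm_le _ h1 (mulL μ a (ι k))
    _ ≤ ‖a‖ * ‖k‖ := by
        rw [one_mul, ← ι.norm_map k]
        exact norm_mulL_apply_le a _

/-- An isometry satisfies ι*ι = 1. -/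
theorem compressL_one : compressL ι ((memLp_top_const (1 : ℂ)).toLp) = 1 := by
  ext1 k
  have h : mulL μ ((memLp_top_const (1 : ℂ)).toLp) (ι k) = ι k := by
    refine Lp.ext ?_
    filter_upwards [coeFn_mulL (μ := μ) ((memLp_top_const (1 : ℂ)).toLp) (ι k),
      MemLp.coeFn_toLp (μ := μ) (memLp_top_const (1 : ℂ))] with x h1 h2
    rw [h1, h2, one_mul]
  refine ext_inner_left ℂ fun l => ?_
  rw [inner_compressL, h, ι.inner_map_map]
  rfl

/-- Lax–Milgram for multiplication operators: if `Re a ≥ r > 0` and `|a| ≤ R`, every compression of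
the multiplication by `a` is invertible. -/
theorem isUnit_compressL {a : Lp ℂ ⊤ μ} {r R : ℝ} (hr : 0 < r)
    (ha : ∀ᵐ x ∂μ, r ≤ (a x).re ∧ ‖a x‖ ≤ R) : IsUnit (compressL ι a) := by
  -- For r t ≥ R², |1 - a/t|² = 1 - 2 Re a/t + |a|²/t² ≤ 1 - r/t < 1. The extra summand r keeps t
  -- positive even when R = 0.
  set t : ℝ := R ^ 2 / r + r with ht
  have htpos : 0 < t := by positivity
  have hRt : R ^ 2 * t⁻¹ ≤ r := by
    rw [← div_eq_mul_inv, div_le_iff₀ htpos, ht, mul_add, mul_div_cancel₀ _ hr.ne']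
    nlinarith
  set b : Lp ℂ ⊤ μ := (memLp_top_const (1 : ℂ)).toLp - ((t⁻¹ : ℝ) : ℂ) • a
  have hb : ‖b‖ < 1 := by
    have hbx : ∀ᵐ x ∂μ, ‖b x‖ ≤ √(1 - r * t⁻¹) := by
      filter_upwards [ha, MemLp.coeFn_toLp (μ := μ) (memLp_top_const (1 : ℂ)),
        Lp.coeFn_sub ((memLp_top_const (1 : ℂ)).toLp) (((t⁻¹ : ℝ) : ℂ) • a),
        Lp.coeFn_smul ((t⁻¹ : ℝ) : ℂ) a] with x hx h1 h2 h3
      rw [show b x = 1 - ((t⁻¹ : ℝ) : ℂ) * a x by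
        rw [h2, Pi.sub_apply, h1, h3, Pi.smul_apply, smul_eq_mul]]
      refine (le_abs_self _).trans (Real.abs_le_sqrt ?_)
      have hq : 0 < t⁻¹ := inv_pos.2 htpos
      have hsq : ‖a x‖ ^ 2 ≤ R ^ 2 := by
        have := norm_nonneg (a x)
        nlinarith [hx.2]
      have hexp : ‖1 - ((t⁻¹ : ℝ) : ℂ) * a x‖ ^ 2 =
          1 - 2 * t⁻¹ * (a x).re + t⁻¹ ^ 2 * ‖a x‖ ^ 2 := by
        rw [← Complex.normSq_eq_norm_sq, ← Complex.normSq_eq_norm_sq, Complex.normSq_apply,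
          Complex.normSq_apply]
        simp only [Complex.sub_re, Complex.sub_im, Complex.one_re, Complex.one_im,
          Complex.re_ofReal_mul, Complex.im_ofReal_mul]
        ring
      rw [hexp]
      have h4 : t⁻¹ * r ≤ t⁻¹ * (a x).re := mul_le_mul_of_nonneg_left hx.1 hq.le
      have h5 : t⁻¹ ^ 2 * ‖a x‖ ^ 2 ≤ t⁻¹ ^ 2 * R ^ 2 := by gcongr
      have h6 : t⁻¹ * (R ^ 2 * t⁻¹) ≤ t⁻¹ * r := mul_le_mul_of_nonneg_left hRt hq.le
      nlinarith
    have hnorm : ‖b‖ ≤ √(1 - r * t⁻¹) := by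
      rw [Lp.norm_def, eLpNorm_exponent_top]
      exact ENNReal.toReal_le_of_le_ofReal (Real.sqrt_nonneg _) (eLpNormEssSup_le_of_ae_bound hbx)
    refine hnorm.trans_lt ?_
    rw [Real.sqrt_lt' one_pos]
    have : 0 < r * t⁻¹ := by positivity
    linarith
  -- Neumann series: 1 - B(b) equals t⁻¹B(a), and ‖B(b)‖ ≤ ‖b‖ < 1.
  have hunit : IsUnit (1 - compressL ι b) :=
    (Units.oneSub (compressL ι b) ((norm_compressL_le ι b).trans_lt hb)).isUnit
  have hcalc : 1 - compressL ι b = ((t⁻¹ : ℝ) : ℂ) • compressL ι a := by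
    simp only [b, map_sub, map_smul, compressL_one]
    exact sub_sub_cancel _ _
  have ht0 : ((t⁻¹ : ℝ) : ℂ) ≠ 0 := by exact_mod_cast (inv_pos.2 htpos).ne'
  rw [hcalc] at hunit
  exact (isUnit_smul_iff (Units.mk0 _ ht0) _).1 hunit

end compressL

/-- The form is the inner product of the nonlocal gradients weighted by the coefficient. -/
theorem form_eq_inner {d : ℕ} {Ω : Set (EuclideanSpace ℝ (Fin d))} {γ₁ : ℝ → ℝ}
    (hγ : IsKernelProfile d γ₁) {δ : ℝ} (hδ : 0 < δ) (a : Lp ℂ ⊤ (vol₂ Ω δ))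
    (u v : EnergySpace Ω γ₁ δ) :
    form a u v = inner ℂ (EnergySpace.gradL2 Ω γ₁ δ v)
      (mulL (vol₂ Ω δ) a (EnergySpace.gradL2 Ω γ₁ δ u)) := by
  rw [L2.inner_def, form]
  refine integral_congr_ae ?_
  filter_upwards [MemLp.coeFn_toLp (EnergySpace.memLp_grad u),
    MemLp.coeFn_toLp (EnergySpace.memLp_grad v),
    coeFn_mulL a (EnergySpace.gradL2 Ω γ₁ δ u)] with p hu hv hm
  have hk : 0 ≤ kernel d γ₁ δ ‖p.2 - p.1‖ :=
    mul_nonneg (by positivity) (hγ.nonneg _ (by positivity))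
  have hu' : EnergySpace.gradL2 Ω γ₁ δ u p = grad γ₁ δ u p := hu
  have hv' : EnergySpace.gradL2 Ω γ₁ δ v p = grad γ₁ δ v p := hv
  rw [hm, hu', hv', RCLike.inner_apply, grad, grad, map_mul, Complex.conj_ofReal]
  nth_rewrite 1 [← Real.mul_self_sqrt hk]
  push_cast
  ring

/-! ### The Hilbert space of nonlocal gradients -/

namespace EnergySpace

/-- The nonlocal gradients of functions in `S_δ(Ω; ℂ)` form a closed subspace of `L²`. -/
theorem isClosed_range_gradL2 {d : ℕ} (hd : 0 < d) {Ω : Set (EuclideanSpace ℝ (Fin d))}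
    (hΩ : IsOpen Ω) (hΩb : Bornology.IsBounded Ω) {γ₁ : ℝ → ℝ} (hγ : IsKernelProfile d γ₁)
    {δ : ℝ} (hδ : 0 < δ) :
    IsClosed ((LinearMap.range (gradL2 Ω γ₁ δ) : Submodule ℂ (Lp ℂ 2 (vol₂ Ω δ))) :
      Set (Lp ℂ 2 (vol₂ Ω δ))) := by
  obtain ⟨C, hC⟩ := exists_poincare hd hΩ hΩb hγ hδ
  refine isClosed_of_closure_subset fun g hg => ?_
  obtain ⟨x, hx, hxg⟩ := mem_closure_iff_seq_limit.1 hg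
  choose u hu using hx
  have hiso : Isometry (gradL2 Ω γ₁ δ) :=
    AddMonoidHomClass.isometry_of_norm (gradL2 Ω γ₁ δ) fun _ => rfl
  have hucau : CauchySeq u := by
    refine hiso.isUniformInducing.cauchy_map_iff.1 ?_
    rw [Filter.map_map, show gradL2 Ω γ₁ δ ∘ u = x from funext hu]
    exact hxg.cauchySeq
  -- By Poincaré, convergence of the gradients makes the functions themselves Cauchy in L². Along a
  -- subsequence both converge a.e., which identifies g with the gradient of w.
  obtain ⟨w, hw⟩ := cauchySeq_tendsto_of_complete
    (((toL2 Ω γ₁ δ).mkContinuous C hC).uniformContinuous.comp_cauchySeq hucau)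
  obtain ⟨φ, hφ, hφw⟩ := (tendstoInMeasure_of_tendsto_Lp hw).exists_seq_tendsto_ae
  obtain ⟨ψ, hψ, hψg⟩ :=
    (tendstoInMeasure_of_tendsto_Lp (hxg.comp hφ.tendsto_atTop)).exists_seq_tendsto_ae
  have hconv : ∀ᵐ y ∂(vol Ω δ), Tendsto (fun i => u (φ (ψ i)) y) atTop (𝓝 (w y)) := by
    filter_upwards [hφw] with y hy
    exact hy.comp hψ.tendsto_atTop
  have hconv₂ : ∀ᵐ p ∂(vol₂ Ω δ),
      Tendsto (fun i => u (φ (ψ i)) p.1) atTop (𝓝 (w p.1)) ∧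
      Tendsto (fun i => u (φ (ψ i)) p.2) atTop (𝓝 (w p.2)) :=
    (Measure.quasiMeasurePreserving_fst.ae hconv).and (Measure.quasiMeasurePreserving_snd.ae hconv)
  have hgrad : ∀ᵐ p ∂(vol₂ Ω δ), ∀ n, x n p = grad γ₁ δ (u n) p := by
    refine ae_all_iff.2 fun n => ?_
    rw [← hu n]
    exact MemLp.coeFn_toLp (memLp_grad (u n))
  have hgw : grad γ₁ δ w =ᵐ[vol₂ Ω δ] g := by
    filter_upwards [hconv₂, hψg, hgrad] with p hp hpg hpx
    refine tendsto_nhds_unique ?_ hpg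
    simp only [Function.comp_apply, hpx, grad]
    exact (hp.2.sub hp.1).const_mul _
  have hwmem : MemLp (grad γ₁ δ w) 2 (vol₂ Ω δ) := (memLp_congr_ae hgw).2 (Lp.memLp g)
  have hw0 : ∀ᵐ y ∂(vol Ω δ), y ∈ collar Ω δ → w y = 0 := by
    have hu0 : ∀ᵐ y ∂(vol Ω δ), ∀ n, y ∈ collar Ω δ → u n y = 0 :=
      ae_all_iff.2 fun n => (u n).2.2
    filter_upwards [hconv, hu0] with y hy h0 hyc
    refine tendsto_nhds_unique hy ?_
    simp only [fun n => h0 n hyc, tendsto_const_nhds]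
  refine ⟨(⟨w, hwmem, hw0⟩ : energySubmodule Ω γ₁ δ), Lp.ext ?_⟩
  exact (MemLp.coeFn_toLp hwmem).trans hgw

/-- By Poincaré, a function with zero gradient has zero L² norm. -/
theorem gradL2_injective {d : ℕ} (hd : 0 < d) {Ω : Set (EuclideanSpace ℝ (Fin d))}
    (hΩ : IsOpen Ω) (hΩb : Bornology.IsBounded Ω) {γ₁ : ℝ → ℝ} (hγ : IsKernelProfile d γ₁)
    {δ : ℝ} (hδ : 0 < δ) : Function.Injective (gradL2 Ω γ₁ δ) := by
  obtain ⟨C, hC⟩ := exists_poincare hd hΩ hΩb hγ hδ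
  refine (injective_iff_map_eq_zero _).2 fun u hu => ?_
  have h := hC u
  rw [hu, norm_zero, mul_zero, norm_le_zero_iff] at h
  exact (Submodule.injective_subtype (energySubmodule Ω γ₁ δ)) (h.trans (map_zero _).symm)

/-- The energy space is isometric to the space of nonlocal gradients. -/
def gradEquiv {d : ℕ} {Ω : Set (EuclideanSpace ℝ (Fin d))} {γ₁ : ℝ → ℝ} {δ : ℝ}
    (hinj : Function.Injective (gradL2 Ω γ₁ δ)) :
    EnergySpace Ω γ₁ δ ≃ₗᵢ[ℂ] LinearMap.range (gradL2 Ω γ₁ δ) where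
  toLinearEquiv := LinearEquiv.ofInjective (gradL2 Ω γ₁ δ) hinj
  norm_map' _ := rfl

end EnergySpace

/-! ### Solvability and holomorphy -/

/-- Riesz representation of antilinear functionals. -/
theorem exists_inner_eq {K : Type*} [NormedAddCommGroup K] [InnerProductSpace ℂ K]
    [CompleteSpace K] (f : K →L⋆[ℂ] ℂ) : ∃ F : K, ∀ k, f k = inner ℂ k F := by
  -- The conjugate of f is linear, so the usual Riesz theorem applies to it.
  refine ⟨(InnerProductSpace.toDual ℂ K).symm ((starL ℂ : ℂ ≃L⋆[ℂ] ℂ).toContinuousLinearMap.comp f),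
    fun k => ?_⟩
  rw [← inner_conj_symm, InnerProductSpace.toDual_symm_apply]
  simp

open Asymptotics in
/-- Composing with a continuous linear map preserves differentiability; the target need not be
separated. -/
theorem differentiableOn_clm_comp {E V S : Type*} [NormedAddCommGroup E] [NormedSpace ℂ E]
    [NormedAddCommGroup V] [NormedSpace ℂ V] [SeminormedAddCommGroup S] [NormedSpace ℂ S]
    (L : V →L[ℂ] S) {g : E → V} {s : Set E} (hg : DifferentiableOn ℂ g s) :
    DifferentiableOn ℂ (fun x => L (g x)) s := by
  intro x hx
  obtain ⟨g', hg'⟩ := hg x hx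
  -- The remainder of L ∘ g is L applied to the remainder of g, and bounded maps preserve little-o.
  refine ⟨L.comp g', .of_isLittleOTVS ?_⟩
  refine (L.isBigOTVS_comp.trans_isLittleOTVS hg'.isLittleOTVS).congr_left fun p => ?_
  simp

open EnergySpace in
/-- Solvability and holomorphic dependence on the coefficient, for an energy space isometric to a
Hilbert space of nonlocal gradients. -/
theorem exists_isOpen_holomorphic_solution {d N : ℕ} {Ω : Set (EuclideanSpace ℝ (Fin d))}
    {δ : ℝ} (hδ : 0 < δ) {γ₁ : ℝ → ℝ} (hγ : IsKernelProfile d γ₁) {V : Type*}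
    [NormedAddCommGroup V] [InnerProductSpace ℂ V] [CompleteSpace V]
    (ι : V →ₗᵢ[ℂ] Lp ℂ 2 (vol₂ Ω δ)) (e : EnergySpace Ω γ₁ δ ≃ₗᵢ[ℂ] V)
    (he : ∀ u, ι (e u) = gradL2 Ω γ₁ δ u)
    {A : (Fin N → ℂ) → Lp ℂ ⊤ (vol₂ Ω δ)} (hA : Differentiable ℂ A) {r R : ℝ} (hr : 0 < r)
    (hell : ∀ ξ ∈ polydisc N, ∀ᵐ p ∂(vol₂ Ω δ), r ≤ (A ξ p).re ∧ ‖A ξ p‖ ≤ R) :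
    ∃ U : Set (Fin N → ℂ), IsOpen U ∧ polydisc N ⊆ U ∧
      ∀ f : EnergySpace Ω γ₁ δ →L⋆[ℂ] ℂ,
        (∀ ξ ∈ U, ∃! w : EnergySpace Ω γ₁ δ, IsWeakSolution (A ξ) f w) ∧
        ∃ u : (Fin N → ℂ) → EnergySpace Ω γ₁ δ,
          (∀ ξ ∈ U, IsWeakSolution (A ξ) f (u ξ)) ∧ DifferentiableOn ℂ u U := by
  have hB : Differentiable ℂ fun ξ => compressL ι (A ξ) := by
    have h : Differentiable ℂ (compressL ι) := (compressL ι).differentiable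
    exact h.comp hA
  refine ⟨{ξ | IsUnit (compressL ι (A ξ))}, Units.isOpen.preimage hB.continuous, fun ξ hξ =>
    isUnit_compressL ι hr (hell ξ hξ), fun f => ?_⟩
  obtain ⟨F, hF⟩ := exists_inner_eq (f.comp (e.symm.toContinuousLinearEquiv : V →L[ℂ] _))
  -- Every element of V is some `e v`, so testing against all v is an equation in V.
  have hweak : ∀ a w, IsWeakSolution a f w ↔ compressL ι a (e w) = F := by
    intro a w
    have hform : ∀ v, form a w v = inner ℂ (e v) (compressL ι a (e w)) := fun v => by
      rw [inner_compressL, form_eq_inner hγ hδ, he, he]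
    have hf : ∀ v, f v = inner ℂ (e v) F := fun v => by
      rw [← hF (e v)]
      simp
    simp only [IsWeakSolution, hform, hf]
    refine ⟨fun h => ext_inner_left ℂ fun k => ?_, fun h v => by rw [h]⟩
    simpa using h (e.symm k)
  have hsol : ∀ ξ, IsUnit (compressL ι (A ξ)) →
      IsWeakSolution (A ξ) f (e.symm (Ring.inverse (compressL ι (A ξ)) F)) := by
    intro ξ hξ
    rw [hweak, e.apply_symm_apply, ← mul_apply_eq_comp, Ring.mul_inverse_cancel _ hξ,
      one_apply_eq_self]
  refine ⟨fun ξ hξ => ⟨_, hsol ξ hξ, fun w hw => ?_⟩, _, hsol, ?_⟩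
  · change IsWeakSolution _ _ _ at hw
    rw [hweak] at hw
    rw [← hw, ← mul_apply_eq_comp, Ring.inverse_mul_cancel _ hξ,
      one_apply_eq_self, e.symm_apply_apply]
  · refine differentiableOn_clm_comp
      (e.symm.toContinuousLinearEquiv : V →L[ℂ] EnergySpace Ω γ₁ δ) ?_
    refine DifferentiableOn.clm_apply (fun ξ hξ => ?_) (differentiableOn_const F)
    exact ((differentiableAt_inverse hξ).comp ξ hB.differentiableAt).differentiableWithinAt

end NonlocalDiffusion

end

theorem mainTheorem3 (d N : ℕ) (hd : 0 < d)
    (Ω : Set (EuclideanSpace ℝ (Fin d))) (hΩ : IsOpen Ω) (hΩb : Bornology.IsBounded Ω)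
    (δ : ℝ) (hδ : 0 < δ)
    (γ₁ : ℝ → ℝ) (hγ : NonlocalDiffusion.IsKernelProfile d γ₁)
    (A : (Fin N → ℂ) → Lp ℂ ⊤ (NonlocalDiffusion.vol₂ Ω δ)) (hA : Differentiable ℂ A)
    (r R : ℝ) (hr : 0 < r)
    (hell : ∀ ξ ∈ NonlocalDiffusion.polydisc N, ∀ᵐ p ∂(NonlocalDiffusion.vol₂ Ω δ),
      r ≤ (A ξ p).re ∧ (A ξ p).re ≤ ‖A ξ p‖ ∧ ‖A ξ p‖ ≤ R) :
    ∃ U : Set (Fin N → ℂ), IsOpen U ∧ NonlocalDiffusion.polydisc N ⊆ U ∧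
      ∀ f : NonlocalDiffusion.EnergySpace Ω γ₁ δ →L⋆[ℂ] ℂ,
        (∀ ξ ∈ U, ∃! w : NonlocalDiffusion.EnergySpace Ω γ₁ δ,
          NonlocalDiffusion.IsWeakSolution (A ξ) f w) ∧
        ∃ u : (Fin N → ℂ) → NonlocalDiffusion.EnergySpace Ω γ₁ δ,
          (∀ ξ ∈ U, NonlocalDiffusion.IsWeakSolution (A ξ) f (u ξ)) ∧
          DifferentiableOn ℂ u U := by
  have hcl := NonlocalDiffusion.EnergySpace.isClosed_range_gradL2 hd hΩ hΩb hγ hδ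
  have hcomplete := hcl.completeSpace_coe
  exact NonlocalDiffusion.exists_isOpen_holomorphic_solution hδ hγ
    (LinearMap.range (NonlocalDiffusion.EnergySpace.gradL2 Ω γ₁ δ)).subtypeₗᵢ
    (NonlocalDiffusion.EnergySpace.gradEquiv
      (NonlocalDiffusion.EnergySpace.gradL2_injective hd hΩ hΩb hγ hδ))
    (fun _ => rfl) hA hr fun ξ hξ => (hell ξ hξ).mono fun p hp => ⟨hp.1, hp.2.2⟩
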